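/- A restriction semigroup is an algebra $(S;\cdot,{}^+,{}^*)$ of type $(2,1,1)$ such that $(S;\cdot)$ is a semigroup, the identities \[x^+x=x,\quad x^+y^+=y^+x^+,\quad (x^+y)^+=x^+y^+,\quad xy^+=(xy)^+x,\] their left-right duals \[xx^*=x,\quad x^*y^*=y^*x^*,\quad (yx^*)^*=y^*x^*,\quad y^*x=x(yx)^*,\] and $(x^+)^*=x^+$, $(x^*)^+=x^*$ hold. A restriction monoid is a restriction semigroup with an identity element. $(2,1,1)$-morphisms preserve all three operations, and a $(2,1,1)$-embedding is an injective $(2,1,1)$-morphism (it need not preserve identity elements). Put $P(S)=\{x^+:x\in S\}=\{x^*:x\in S\}$; let $a\le b$ mean $a=a^+b$, and let $a\,\sigma\,b$ mean $ea=eb$ for some $e\in P(S)$. $S$ is proper if each of $(a^+=b^+,\ a\,\sigma\,b)$ and $(a^*=b^*,\ a\,\sigma\,b)$ implies $a=b$. A proper cover of $S$ is a proper restriction semigroup $C$ that has a surjective $(2,1,1)$-morphism onto $S$ which is injective on $P(C)$. A restriction monoid $F$ is factorisable if $F=P(F)U(F)$, where $U(F)=\{u\in F:u^+=u^*=1\}$.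 A subset $A\subseteq S$ is permissible if it is an order ideal for $\le$ and $a^+b=b^+a$, $ab^*=ba^*$ for all $a,b\in A$. A restriction semigroup $S$ is almost factorisable if each element of $S$ lies in a permissible set $A$ with $\{a^+:a\in A\}=\{a^*:a\in A\}=P(S)$. If a monoid $T$ acts on a (meet-)semilattice $Y$ on the left by automorphisms, the semidirect product $Y\rtimes T$ is the restriction semigroup on $Y\times T$ with \[(a,t)(b,u)=(a\wedge t\cdot b,\,tu),\qquad (a,t)^+=(a,1),\qquad (t\cdot a,t)^*=(a,1).\] It is nice if there are a group $G$ containing $T$ as a submonoid, an action of $G$ on $Y$ extending that of $T$, and an element $\mathbf 1\in Y$ such that every element of $Y$ is of the form $g\cdot y$ with $g\in G$, $y\le\mathbf 1$, and every $g\in G$ has a factorisation $g=w_1\cdots w_n$ with $w_i=t_i^{\epsilon_i}$, $t_i\in T$, $\epsilon_i\in\{1,-1\}$, where $\epsilon_i=\epsilon_j$ if and only if $2\mid i-j$, and $w_i\cdot\mathbf 1\ge\mathbf 1\wedge w_i\cdots w_n\cdot\mathbf 1$ for $1\le i<n$. Theorem. Let $S$ be a restriction semigroup. (i) $S$ is $(2,1,1)$-embeddable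 in an almost factorisable restriction semigroup, which moreover is a $(2,1,1)$-morphic image of a semidirect product of a semilattice by a monoid acting by automorphisms. Also, $S$ is $(2,1,1)$-embeddable in a factorisable restriction monoid, which moreover is a $(2,1,1)$-morphic image of a semidirect product of a semilattice with identity by a monoid acting by automorphisms. (ii) $S$ has a proper cover $C$ such that $C$ is $(2,1,1)$-embeddable in a nice semidirect product of a semilattice by a monoid, and $C$ is also $(2,1,1)$-embeddable in a semidirect product of a semilattice by a group. -/

import Mathlib

universe u v w

/-- A restriction semigroup: an algebra of type (2,1,1), with `plus x` for `x⁺` and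
`ast x` for `x^*`, which is a left and a right restriction semigroup such that
`(x⁺)^* = x⁺` and `(x^*)⁺ = x^*`. -/
class RestrictionSemigroup (S : Type u) extends Semigroup S where
  plus : S → S
  ast : S → S
  plus_mul_self : ∀ x : S, plus x * x = x
  plus_mul_comm : ∀ x y : S, plus x * plus y = plus y * plus x
  plus_plus_mul : ∀ x y : S, plus (plus x * y) = plus x * plus y
  mul_plus : ∀ x y : S, x * plus y = plus (x * y) * x
  self_mul_ast : ∀ x : S, x * ast x = x
  ast_mul_comm : ∀ x y : S, ast x * ast y = ast y * ast x
  ast_mul_ast : ∀ x y : S, ast (y * ast x) = ast y * ast x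
  ast_mul : ∀ x y : S, ast y * x = x * ast (y * x)
  ast_plus : ∀ x : S, ast (plus x) = plus x
  plus_ast : ∀ x : S, plus (ast x) = ast x

/-- A restriction monoid: a restriction semigroup with an identity element. -/
class RestrictionMonoid (S : Type u) extends RestrictionSemigroup S, Monoid S

namespace RestrictionSemigroup

/-- The set `P(S) = {x⁺ : x ∈ S} = {x^* : x ∈ S}` of projections. -/
def projections (S : Type u) [RestrictionSemigroup S] : Set S :=
  Set.range (plus : S → S)

/-- The natural partial order: `a ≤ b` if and only if `a = a⁺ b`. -/
def NatLE {S : Type u} [RestrictionSemigroup S] (a b : S) : Prop :=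
  a = plus a * b

/-- The least reduced congruence `σ`: `ea = eb` for some projection `e`. -/
def Sigma {S : Type u} [RestrictionSemigroup S] (a b : S) : Prop :=
  ∃ e ∈ projections S, e * a = e * b

/-- Proper restriction semigroups. -/
def IsProper (S : Type u) [RestrictionSemigroup S] : Prop :=
  (∀ a b : S, plus a = plus b → Sigma a b → a = b) ∧
    (∀ a b : S, ast a = ast b → Sigma a b → a = b)

/-- `(2,1,1)`-morphisms. -/
structure IsHom {S : Type u} {T : Type v} [RestrictionSemigroup S] [RestrictionSemigroup T]
    (φ : S → T) : Prop where
  map_mul : ∀ x y : S, φ (x * y) = φ x * φ y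
  map_plus : ∀ x : S, φ (plus x) = plus (φ x)
  map_ast : ∀ x : S, φ (ast x) = ast (φ x)

/-- `S` is `(2,1,1)`-embeddable in `T`. -/
def Embeds (S : Type u) (T : Type v) [RestrictionSemigroup S] [RestrictionSemigroup T] : Prop :=
  ∃ φ : S → T, IsHom φ ∧ Function.Injective φ

/-- `T` is a `(2,1,1)`-morphic image of `S`. -/
def IsMorphicImage (S : Type u) (T : Type v) [RestrictionSemigroup S]
    [RestrictionSemigroup T] : Prop :=
  ∃ φ : S → T, IsHom φ ∧ Function.Surjective φ

/-- `C` is a proper cover of `S`: `C` is proper, and there is a projection separating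
`(2,1,1)`-morphism from `C` onto `S`. -/
def IsProperCover (C : Type u) (S : Type v) [RestrictionSemigroup C]
    [RestrictionSemigroup S] : Prop :=
  IsProper C ∧ ∃ φ : C → S, IsHom φ ∧ Function.Surjective φ ∧
    ∀ e ∈ projections C, ∀ f ∈ projections C, φ e = φ f → e = f

/-- `A ⊆ S` is permissible: an order ideal for the natural partial order, any two elements of
which are compatible. -/
def Permissible {S : Type u} [RestrictionSemigroup S] (A : Set S) : Prop :=
  (∀ a ∈ A, ∀ x : S, NatLE x a → x ∈ A) ∧
    (∀ a ∈ A, ∀ b ∈ A, plus a * b = plus b * a ∧ a * ast b = b * ast a)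

/-- `S` is almost factorisable: each element of `S` belongs to a permissible set `A` with
`A⁺ = A^* = P(S)`, i.e. with `A ∈ U(C(S))` where `C(S)` is the restriction monoid of permissible
subsets of `S`, whose identity is `P(S)`. -/
def IsAlmostFactorisable (S : Type u) [RestrictionSemigroup S] : Prop :=
  ∀ s : S, ∃ A : Set S, Permissible A ∧ s ∈ A ∧
    plus '' A = projections S ∧ ast '' A = projections S

/-- The reduced subsemigroup `U(F) = {u : u⁺ = u^* = 1}` of a restriction monoid. -/
def units (F : Type u) [RestrictionMonoid F] : Set F :=
  {u | plus u = 1 ∧ ast u = 1}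

/-- A restriction monoid `F` is factorisable if `F = P(F) U(F)`. -/
def IsFactorisable (F : Type u) [RestrictionMonoid F] : Prop :=
  ∀ a : F, ∃ e ∈ projections F, ∃ t ∈ units F, a = e * t

end RestrictionSemigroup

/-- The underlying set `Y × T` of the semidirect product `Y ⋊ T` of a (meet-)semilattice `Y` by a
monoid `T` acting on `Y` on the left by automorphisms through `α`
(order automorphisms of a semilattice are the same as semilattice automorphisms). -/
@[ext]
structure SemilatticeSemidirect {Y : Type u} {T : Type v} [SemilatticeInf Y] [Monoid T]
    (α : T →* (Y ≃o Y)) where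
  fst : Y
  snd : T

namespace SemilatticeSemidirect

variable {Y : Type u} {T : Type v} [SemilatticeInf Y] [Monoid T]

/-- The operations `(a,t)(b,u) = (a ∧ t·b, tu)`, `(a,t)⁺ = (a,1)` and `(t·a,t)^* = (a,1)`. -/
instance (α : T →* (Y ≃o Y)) : RestrictionSemigroup (SemilatticeSemidirect α) where
  mul x y := ⟨x.fst ⊓ α x.snd y.fst, x.snd * y.snd⟩
  plus x := ⟨x.fst, 1⟩
  ast x := ⟨(α x.snd).symm x.fst, 1⟩
  mul_assoc x y z := by
    apply SemilatticeSemidirect.ext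
    · change (x.fst ⊓ α x.snd y.fst) ⊓ α (x.snd * y.snd) z.fst
        = x.fst ⊓ α x.snd (y.fst ⊓ α y.snd z.fst)
      simp [inf_assoc]
    · exact mul_assoc x.snd y.snd z.snd
  plus_mul_self x := by
    apply SemilatticeSemidirect.ext
    · change x.fst ⊓ α 1 x.fst = x.fst
      simp
    · exact one_mul x.snd
  plus_mul_comm x y := by
    apply SemilatticeSemidirect.ext
    · change x.fst ⊓ α 1 y.fst = y.fst ⊓ α 1 x.fst
      simp [inf_comm]
    · rfl
  plus_plus_mul x y := by
    apply SemilatticeSemidirect.ext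
    · rfl
    · exact (mul_one (1 : T)).symm
  mul_plus x y := by
    apply SemilatticeSemidirect.ext
    · change x.fst ⊓ α x.snd y.fst = (x.fst ⊓ α x.snd y.fst) ⊓ α 1 x.fst
      simp
    · change x.snd * 1 = 1 * x.snd
      simp
  self_mul_ast x := by
    apply SemilatticeSemidirect.ext
    · change x.fst ⊓ α x.snd ((α x.snd).symm x.fst) = x.fst
      simp
    · exact mul_one x.snd
  ast_mul_comm x y := by
    apply SemilatticeSemidirect.ext
    · change (α x.snd).symm x.fst ⊓ α 1 ((α y.snd).symm y.fst)
        = (α y.snd).symm y.fst ⊓ α 1 ((α x.snd).symm x.fst)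
      simp [inf_comm]
    · rfl
  ast_mul_ast x y := by
    apply SemilatticeSemidirect.ext
    · change (α (y.snd * 1)).symm (y.fst ⊓ α y.snd ((α x.snd).symm x.fst))
        = (α y.snd).symm y.fst ⊓ α 1 ((α x.snd).symm x.fst)
      simp
    · exact (mul_one (1 : T)).symm
  ast_mul x y := by
    apply SemilatticeSemidirect.ext
    · change (α y.snd).symm y.fst ⊓ α 1 x.fst
        = x.fst ⊓ α x.snd ((α (y.snd * x.snd)).symm (y.fst ⊓ α y.snd x.fst))
      have h : ∀ z : Y, α x.snd ((α (y.snd * x.snd)).symm z) = (α y.snd).symm z := by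
        intro z
        apply (α y.snd).injective
        rw [← RelIso.mul_apply, ← map_mul]
        simp
      rw [h]
      simp [inf_comm]
    · change 1 * x.snd = x.snd * 1
      simp
  ast_plus x := by
    apply SemilatticeSemidirect.ext
    · change (α 1).symm x.fst = x.fst
      rw [OrderIso.symm_apply_eq]
      simp
    · rfl
  plus_ast x := rfl

end SemilatticeSemidirect

/-- A nice factorisation `g = w₁ w₂ ⋯ wₙ` in the submonoid `ι(T)` of the group `G` with respect to
`o ∈ X`: `wᵢ = tᵢ^{εᵢ}` with `tᵢ ∈ T`, `εᵢ ∈ {1,-1}`, where `εᵢ = εⱼ` iff `2 ∣ i - j`, and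
`wᵢ·o ≥ o ∧ wᵢ⋯wₙ·o` for all `i < n` (indices start from `0` below). -/
def IsNiceFactorisation {X : Type u} {T : Type v} {G : Type w} [SemilatticeInf X] [Monoid T]
    [Group G] (ι : T →* G) (β : G →* (X ≃o X)) (o : X) (g : G) (n : ℕ) (w : Fin n → G) : Prop :=
  (∃ (t : Fin n → T) (ε : Fin n → ℤˣ), (∀ i, w i = ι (t i) ^ ((ε i : ℤˣ) : ℤ)) ∧
      ∀ i j : Fin n, ε i = ε j ↔ (2 : ℤ) ∣ (((i : ℕ) : ℤ) - ((j : ℕ) : ℤ))) ∧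
    (List.ofFn w).prod = g ∧
    ∀ i : Fin n, (i : ℕ) + 1 < n →
      o ⊓ β ((List.ofFn w).drop (i : ℕ)).prod o ≤ β (w i) o

/-- The semidirect product `X ⋊ T` given by the action `α` of `T` on `X` is nice: there is a group
`G` having `T` as a submonoid (via `ι`), an action `β` of `G` on `X` extending that of `T`, and an
element `o` of `X` such that `X = G·Y` for the principal ideal `Y` with identity `o`, and each
element of `G` has a nice factorisation in `T` with respect to `o`. -/
def IsNiceSemidirect {X : Type u} {T : Type v} [SemilatticeInf X] [Monoid T]
    (α : T →* (X ≃o X)) : Prop :=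
  ∃ (G : Type v) (_ : Group G) (ι : T →* G) (β : G →* (X ≃o X)) (o : X),
    Function.Injective ι ∧ (∀ t : T, β (ι t) = α t) ∧
    (∀ x : X, ∃ (g : G) (y : X), y ≤ o ∧ x = β g y) ∧
    ∀ g : G, ∃ (n : ℕ) (w : Fin n → G), IsNiceFactorisation ι β o g n w

/-!
Two constructions carry the proof. Write `P` for the semilattice of projections of `S`. An element `s`
of `S` acts on `P` as a partial bijection, which maps `p ≤ s^*` to `(sp)⁺`, with inverse
`q ↦ (qs)^*`. It is an order isomorphism between principal ideals.

*Factorisable monoids.* `S` is thought of as a category with set of objects `P`, in which `s` is an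
arrow from `s^*` to `s⁺`. The set of all arrows below `s` then contains one arrow from each object
below `s^*`, and one arrow to each object below `s⁺`. Adding a second copy of `P` as new objects, and
a zero arrow between any two objects, makes room to extend each such set of arrows to a permutation
of all objects that is labelled by arrows (`dilation`, `extend`). Labelled permutations form a monoid
(`LabelledPerm`), which acts on the semilattice `Y` of all sets of objects. The quotient of the
semidirect product of `Y` by this monoid, where `(A, t)` and `(A, u)` are identified if the arrows of
`t` and `u` that end in `A` agree, is a factorisable restriction monoid, as `Y` has a greatest
element. It contains `S`, since `s` is determined by its restriction to `s⁺`
(`isHom_toGermMonoid`, `toGermMonoid_injective`). A factorisable restriction monoid is almost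
factorisable (`IsFactorisable.isAlmostFactorisable`), so this monoid serves for both claims of (i).

*Proper covers.* The cover consists of the pairs `(s, w)` of an element and a word with letters in `S`
such that `s` lies below the product of `w` (`Cover`). The partial bijections above make the free
group `G` on `S` act partially on `P`, through reduced words. Each `e` in `P` is represented by the
set `below e` of all `(h, p)` in `G × P` such that `h` maps `p` below `e`; here `G` acts totally, by
left translation. The point is that `w` maps `below (s^*)` to `below (s⁺)` for `(s, w)` in the cover
(`Cover.below_plus_elem`), which makes `(s, w) ↦ (below (s⁺), w)` an embedding in a semidirect product
by the free monoid on `S`, and so also in one by `G`. Properness is inherited from the semidirect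
product. For niceness, the element with respect to which words are factorised is the set of all
`(h, p)` such that `h` is defined at `p`. For fixed `p` these `h` form a subtree of the Cayley graph
of `G`. The nice factorisation of a group element is its reduced word, cut where the signs of the
letters change, and the required inequalities say that subtrees of a tree are convex
(`IsDefinedAt.of_append`).
-/

namespace RestrictionSemigroup

/-! ### Identities and the semilattice of projections -/

section Identities

variable {S : Type u} [RestrictionSemigroup S]

theorem plus_plus (x : S) : plus (plus x) = plus x := by
  simpa only [ast_plus] using plus_ast (plus x)

theorem plus_mul_plus (x y : S) : plus (x * plus y) = plus (x * y) := by
  rw [mul_plus, plus_plus_mul, plus_mul_comm, ← plus_plus_mul, ← mul_assoc, plus_mul_self]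

theorem ast_ast_mul (x y : S) : ast (ast x * y) = ast (x * y) := by
  rw [ast_mul, ast_mul_ast, ast_mul_comm, ← ast_mul_ast, mul_assoc, self_mul_ast]

theorem plus_mul_plus_mul (x y : S) : plus x * plus (x * y) = plus (x * y) := by
  rw [← plus_plus_mul, ← mul_assoc, plus_mul_self]

theorem ast_mul_mul_ast (x y : S) : ast (x * y) * ast y = ast (x * y) := by
  rw [← ast_mul_ast, mul_assoc, self_mul_ast]

/-- The projection `x⁺`, as an element of the type of projections. -/
def plusProj (x : S) : projections S := ⟨plus x, x, rfl⟩

/-- The projection `x^*`, as an element of the type of projections. -/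
def astProj (x : S) : projections S := ⟨ast x, ast x, plus_ast x⟩

@[simp] theorem coe_plusProj (x : S) : (plusProj x : S) = plus x := rfl

@[simp] theorem coe_astProj (x : S) : (astProj x : S) = ast x := rfl

@[simp] theorem plus_coe (e : projections S) : plus (e : S) = e := by
  obtain ⟨_, x, rfl⟩ := e
  exact plus_plus x

@[simp] theorem ast_coe (e : projections S) : ast (e : S) = e := by
  obtain ⟨_, x, rfl⟩ := e
  exact ast_plus x

@[simp] theorem plusProj_coe (e : projections S) : plusProj (e : S) = e := Subtype.ext (plus_coe e)

@[simp] theorem astProj_coe (e : projections S) : astProj (e : S) = e := Subtype.ext (ast_coe e)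

theorem coe_mul_coe_self (e : projections S) : (e : S) * e = e := by
  simpa only [plus_coe] using plus_mul_self (e : S)

theorem coe_mul_coe_comm (e f : projections S) : (e : S) * f = f * e := by
  simpa only [plus_coe] using plus_mul_comm (e : S) (f : S)

/-- The projections form a semilattice: `e ≤ f` means `ef = e`, and meets are products. -/
instance : SemilatticeInf (projections S) where
  le e f := (e : S) * f = e
  inf e f := ⟨e * f, (e : S) * f, by
    simpa only [plus_coe] using plus_plus_mul (e : S) (f : S)⟩
  le_refl e := coe_mul_coe_self e
  le_trans e f g hef hfg := by
    rw [← hef, mul_assoc, hfg]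
  le_antisymm e f hef hfe := by
    apply Subtype.ext
    rw [← hef, coe_mul_coe_comm, hfe]
  inf_le_left e f := by
    change (e : S) * f * e = e * f
    rw [coe_mul_coe_comm e f, mul_assoc, coe_mul_coe_self]
  inf_le_right e f := by
    change (e : S) * f * f = e * f
    rw [mul_assoc, coe_mul_coe_self]
  le_inf e f g hf hg := by
    change (e : S) * (f * g) = e
    rw [← mul_assoc, hf, hg]

theorem proj_le_iff {e f : projections S} : e ≤ f ↔ (e : S) * f = e := Iff.rfl

theorem proj_le_iff' {e f : projections S} : e ≤ f ↔ (f : S) * e = e := by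
  rw [coe_mul_coe_comm, proj_le_iff]

theorem coe_inf (e f : projections S) : ((e ⊓ f : projections S) : S) = e * f := rfl

theorem plusProj_mul_le (x y : S) : plusProj (x * y) ≤ plusProj x :=
  proj_le_iff'.2 (plus_mul_plus_mul x y)

theorem astProj_mul_le (x y : S) : astProj (x * y) ≤ astProj y :=
  ast_mul_mul_ast x y

theorem plusProj_mul_plus (x y : S) : plusProj (x * plus y) = plusProj (x * y) :=
  Subtype.ext (plus_mul_plus x y)

theorem astProj_ast_mul (x y : S) : astProj (ast x * y) = astProj (x * y) :=
  Subtype.ext (ast_ast_mul x y)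

theorem plusProj_coe_mul (e : projections S) (x : S) : plusProj (e * x) = e ⊓ plusProj x := by
  apply Subtype.ext
  change plus ((e : S) * x) = e * plus x
  simpa only [plus_coe] using plus_plus_mul (e : S) x

theorem astProj_mul_coe (x : S) (e : projections S) : astProj (x * e) = astProj x ⊓ e := by
  apply Subtype.ext
  change ast (x * (e : S)) = ast x * e
  simpa only [ast_coe] using ast_mul_ast (e : S) x

theorem mul_coe (x : S) (e : projections S) : x * e = plus (x * e) * x := by
  simpa only [plus_coe] using mul_plus x (e : S)

theorem coe_mul (e : projections S) (x : S) : e * x = x * ast (e * x) := by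
  simpa only [ast_coe] using ast_mul x (e : S)

theorem mul_coe_of_astProj_le {e : projections S} {x : S} (h : astProj x ≤ e) :
    x * (e : S) = x := by
  conv_lhs => rw [← self_mul_ast x, mul_assoc]
  rw [show ast x * (e : S) = ast x from h, self_mul_ast]

/-- If `e ≤ x⁺`, then the restriction `ex` of `x` has range `e`. -/
theorem plusProj_coe_mul_of_le {e : projections S} {x : S} (h : e ≤ plusProj x) :
    plusProj (e * x) = e := by
  rw [plusProj_coe_mul, inf_eq_left.2 h]

/-- If `e ≤ x^*`, then the restriction `xe` of `x` has domain `e`. -/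
theorem astProj_mul_coe_of_le {e : projections S} {x : S} (h : e ≤ astProj x) :
    astProj (x * e) = e := by
  rw [astProj_mul_coe, inf_eq_right.2 h]

theorem IsHom.comp {A : Type u} {B : Type v} {C : Type w} [RestrictionSemigroup A]
    [RestrictionSemigroup B] [RestrictionSemigroup C] {g : B → C} {f : A → B}
    (hg : IsHom g) (hf : IsHom f) : IsHom (g ∘ f) where
  map_mul x y := by simp only [Function.comp, hf.map_mul, hg.map_mul]
  map_plus x := by simp only [Function.comp, hf.map_plus, hg.map_plus]
  map_ast x := by simp only [Function.comp, hf.map_ast, hg.map_ast]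

end Identities

end RestrictionSemigroup

/-! ### Semidirect products are proper -/

namespace SemilatticeSemidirect

variable {Y : Type u} {T : Type v} [SemilatticeInf Y] [Monoid T] {α : T →* (Y ≃o Y)}

open RestrictionSemigroup

@[simp] theorem mul_fst (x y : SemilatticeSemidirect α) :
    (x * y).fst = x.fst ⊓ α x.snd y.fst := rfl

@[simp] theorem mul_snd (x y : SemilatticeSemidirect α) : (x * y).snd = x.snd * y.snd := rfl

@[simp] theorem plus_fst (x : SemilatticeSemidirect α) : (plus x).fst = x.fst := rfl

@[simp] theorem plus_snd (x : SemilatticeSemidirect α) : (plus x).snd = 1 := rfl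

@[simp] theorem ast_fst (x : SemilatticeSemidirect α) :
    (ast x).fst = (α x.snd).symm x.fst := rfl

@[simp] theorem ast_snd (x : SemilatticeSemidirect α) : (ast x).snd = 1 := rfl

theorem snd_eq_of_sigma {x y : SemilatticeSemidirect α} (h : Sigma x y) : x.snd = y.snd := by
  obtain ⟨_, ⟨e, rfl⟩, h⟩ := h
  simpa using congrArg snd h

theorem isProper (α : T →* (Y ≃o Y)) : IsProper (SemilatticeSemidirect α) := by
  refine ⟨fun x y h hσ => ?_, fun x y h hσ => ?_⟩
  · exact SemilatticeSemidirect.ext (congrArg fst h :) (snd_eq_of_sigma hσ)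
  · have hs := snd_eq_of_sigma hσ
    have hf : (α x.snd).symm x.fst = (α y.snd).symm y.fst := (congrArg fst h :)
    rw [hs] at hf
    exact SemilatticeSemidirect.ext ((α y.snd).symm.injective hf) hs

end SemilatticeSemidirect

namespace RestrictionSemigroup

/-- A restriction semigroup that embeds in a proper one is proper. -/
theorem IsProper.of_embeds {C : Type u} {D : Type v} [RestrictionSemigroup C]
    [RestrictionSemigroup D] (hD : IsProper D) (h : Embeds C D) : IsProper C := by
  obtain ⟨φ, hφ, hinj⟩ := h
  have hσ : ∀ a b : C, Sigma a b → Sigma (φ a) (φ b) := by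
    rintro a b ⟨_, ⟨e, rfl⟩, h⟩
    refine ⟨_, ⟨φ e, rfl⟩, ?_⟩
    rw [← hφ.map_plus, ← hφ.map_mul, ← hφ.map_mul, h]
  refine ⟨fun a b h h' => hinj (hD.1 _ _ ?_ (hσ a b h')),
    fun a b h h' => hinj (hD.2 _ _ ?_ (hσ a b h'))⟩
  · rw [← hφ.map_plus, ← hφ.map_plus, h]
  · rw [← hφ.map_ast, ← hφ.map_ast, h]

variable {S : Type u} [RestrictionSemigroup S]

/-! ### The partial action of the free group on the projections -/

/-- The partial bijection of the projections induced by a letter `x` or `x⁻¹`, as a relation: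
`x` maps `a^*` to `a⁺` for each `a ≤ x`, and `x⁻¹` maps `a⁺` to `a^*`. -/
def LetterMaps (y : S × Bool) (p q : projections S) : Prop :=
  ∃ a : S, NatLE a y.1 ∧
    cond y.2 (astProj a = p ∧ plusProj a = q) (plusProj a = p ∧ astProj a = q)

theorem letterMaps_not {x : S} {b : Bool} {p q : projections S} :
    LetterMaps (x, !b) p q ↔ LetterMaps (x, b) q p := by
  cases b <;> simp [LetterMaps, and_comm]

/-- The natural partial order is left-right symmetric: `a = a⁺x` implies `a = xa^*`. -/
theorem NatLE.eq_mul_ast {a x : S} (h : NatLE a x) : a = x * ast a := by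
  have h1 : plus a * x = x * ast (plus a * x) := coe_mul (plusProj a) x
  rwa [← show a = plus a * x from h] at h1

theorem natLE_coe_mul (e : projections S) (x : S) : NatLE (e * x) x := by
  unfold NatLE
  rw [← coe_plusProj, plusProj_coe_mul, coe_inf, mul_assoc, coe_plusProj, plus_mul_self]

theorem LetterMaps.unique {y : S × Bool} {p q q' : projections S} (h : LetterMaps y p q)
    (h' : LetterMaps y p q') : q = q' := by
  obtain ⟨x, b⟩ := y
  obtain ⟨a, ha, h⟩ := h
  obtain ⟨a', ha', h'⟩ := h'
  have key : a = a' := by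
    cases b
    · have e : plus a = plus a' := congrArg Subtype.val (h.1.trans h'.1.symm)
      rw [show a = plus a * x from ha, e, ← show a' = plus a' * x from ha']
    · have e : ast a = ast a' := congrArg Subtype.val (h.1.trans h'.1.symm)
      rw [show a = x * ast a from ha.eq_mul_ast, e, ← show a' = x * ast a' from ha'.eq_mul_ast]
  subst key
  cases b <;> exact h.2.symm.trans h'.2

/-- The letters of `L`, applied to `p` from right to left, are successively defined, and the
result is `q`. -/
def WordMaps : List (S × Bool) → projections S → projections S → Prop
  | [], p, q => p = q
  | y :: L, p, q => ∃ r, WordMaps L p r ∧ LetterMaps y r q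

theorem WordMaps.unique {L : List (S × Bool)} {p q q' : projections S} (h : WordMaps L p q)
    (h' : WordMaps L p q') : q = q' := by
  induction L generalizing q q' with
  | nil => exact h.symm.trans h'
  | cons y L ih =>
    obtain ⟨r, hr, h⟩ := h
    obtain ⟨r', hr', h'⟩ := h'
    obtain rfl := ih hr hr'
    exact h.unique h'

open Classical in
/-- Multiplying by a letter either cancels the first letter of the reduced word, or adds a letter. -/
theorem toWord_mk_singleton_mul {α : Type u} (y : α × Bool) (h : FreeGroup α) :
    (∃ L, h.toWord = (y.1, !y.2) :: L ∧ (FreeGroup.mk [y] * h).toWord = L) ∨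
      (h.toWord.head? ≠ some (y.1, !y.2) ∧ (FreeGroup.mk [y] * h).toWord = y :: h.toWord) := by
  have e : (FreeGroup.mk [y] * h).toWord = FreeGroup.reduce (y :: h.toWord) := by
    conv_lhs => rw [← FreeGroup.mk_toWord (x := h), FreeGroup.mul_mk, FreeGroup.toWord_mk]
    rfl
  rw [e, FreeGroup.reduce.cons, FreeGroup.reduce_toWord]
  obtain ⟨x, b⟩ := y
  cases hL : h.toWord with
  | nil => right; simp
  | cons z L =>
    obtain ⟨x', b'⟩ := z
    by_cases hz : x = x' ∧ b = !b'
    · left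
      obtain ⟨rfl, rfl⟩ := hz
      exact ⟨L, by simp, by simp⟩
    · right
      refine ⟨fun hh => hz ?_, by simp [hz]⟩
      simp only [List.head?_cons, Option.some.injEq, Prod.mk.injEq] at hh
      obtain ⟨rfl, rfl⟩ := hh
      simp

open Classical in
/-- The partial action of the free group on `S` on the projections of `S`: a group element acts
by its reduced word. -/
def Reaches (h : FreeGroup S) (p q : projections S) : Prop :=
  WordMaps h.toWord p q

theorem Reaches.unique {h : FreeGroup S} {p q q' : projections S} (hq : Reaches h p q)
    (hq' : Reaches h p q') : q = q' :=
  WordMaps.unique hq hq'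

theorem Reaches.letter_mul {h : FreeGroup S} {p q r : projections S} {y : S × Bool}
    (hq : Reaches h p q) (hr : LetterMaps y q r) : Reaches (FreeGroup.mk [y] * h) p r := by
  rcases toWord_mk_singleton_mul y h with ⟨L, hL, hyL⟩ | ⟨-, hy⟩
  · rw [Reaches, hL] at hq
    obtain ⟨r', hr', hq⟩ := hq
    obtain rfl : r' = r := (letterMaps_not.1 hq).unique hr
    rwa [Reaches, hyL]
  · rw [Reaches, hy]
    exact ⟨q, hq, hr⟩

/-- The group element `h` is defined at `p` under the partial action. For fixed `p` these `h` form
a subtree of the Cayley graph of the free group which contains `1`. -/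
def IsDefinedAt (h : FreeGroup S) (p : projections S) : Prop :=
  ∃ q, Reaches h p q

open Classical in
theorem IsDefinedAt.of_toWord_cons {h k : FreeGroup S} {p : projections S} {y : S × Bool}
    (hk : k.toWord = y :: h.toWord) (hd : IsDefinedAt k p) : IsDefinedAt h p := by
  obtain ⟨q, hq⟩ := hd
  rw [Reaches, hk] at hq
  obtain ⟨r, hr, -⟩ := hq
  exact ⟨r, hr⟩

open Classical in
/-- If the reduced word of `k` begins with `y⁻¹` and `yL` is reduced, then nothing cancels in the
product `L⁻¹k`. So the reduced word of `k` is a final segment of that of `L⁻¹k`, and `k` is defined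
wherever `L⁻¹k` is. -/
theorem IsDefinedAt.of_inv_mk_mul {p : projections S} {L : List (S × Bool)} {y : S × Bool}
    {k : FreeGroup S} (hk : k.toWord.head? = some (y.1, !y.2))
    (hL : FreeGroup.IsReduced (y :: L)) (hd : IsDefinedAt ((FreeGroup.mk L)⁻¹ * k) p) :
    IsDefinedAt k p := by
  induction L generalizing y k with
  | nil => simpa [← FreeGroup.one_eq_mk] using hd
  | cons z L ih =>
    rw [FreeGroup.isReduced_cons_cons] at hL
    rcases toWord_mk_singleton_mul (z.1, !z.2) k with ⟨M, hM, -⟩ | ⟨-, hz⟩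
    · exfalso
      rw [hM] at hk
      simp only [Bool.not_not, List.head?_cons, Option.some.injEq, Prod.mk.injEq] at hk
      have := hL.1 hk.1.symm
      rw [hk.2] at this
      simp at this
    · refine IsDefinedAt.of_toWord_cons hz (ih (y := z) (by rw [hz]; rfl) hL.2 ?_)
      convert hd using 1
      rw [← mul_assoc, show FreeGroup.mk (z :: L) = FreeGroup.mk [z] * FreeGroup.mk L from rfl,
        mul_inv_rev]
      rfl

open Classical in
/-- Subtrees are convex: if `h` and `(L₁L₂)⁻¹h` are defined at `p`, then so is `L₁⁻¹h`, which lies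
on the geodesic between them. -/
theorem IsDefinedAt.of_append {p : projections S} {L₁ L₂ : List (S × Bool)} {h : FreeGroup S}
    (hL : FreeGroup.IsReduced (L₁ ++ L₂)) (hh : IsDefinedAt h p)
    (hd : IsDefinedAt ((FreeGroup.mk (L₁ ++ L₂))⁻¹ * h) p) :
    IsDefinedAt ((FreeGroup.mk L₁)⁻¹ * h) p := by
  induction L₁ generalizing h with
  | nil => simpa [← FreeGroup.one_eq_mk] using hh
  | cons y L ih =>
    have e : ∀ M : List (S × Bool), (FreeGroup.mk (y :: M))⁻¹ * h =
        (FreeGroup.mk M)⁻¹ * (FreeGroup.mk [(y.1, !y.2)] * h) := by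
      intro M
      rw [← mul_assoc, show FreeGroup.mk (y :: M) = FreeGroup.mk [y] * FreeGroup.mk M from rfl,
        mul_inv_rev]
      rfl
    rw [List.cons_append, e] at hd
    rw [e]
    refine ih (hL.infix (List.suffix_cons y (L ++ L₂)).isInfix) ?_ hd
    rcases toWord_mk_singleton_mul (y.1, !y.2) h with ⟨M, hM, hy⟩ | ⟨-, hy⟩
    · exact IsDefinedAt.of_toWord_cons (by rw [hM, hy]) hh
    · exact IsDefinedAt.of_inv_mk_mul (y := y) (by rw [hy]; rfl) hL hd

/-! ### The semilattice of translates -/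

/-- The left translate `gA` of a set `A` of pairs. -/
def translate (g : FreeGroup S) (A : Set (FreeGroup S × projections S)) :
    Set (FreeGroup S × projections S) :=
  {z | (g⁻¹ * z.1, z.2) ∈ A}

theorem translate_mul (g h : FreeGroup S) (A : Set (FreeGroup S × projections S)) :
    translate (g * h) A = translate g (translate h A) := by
  ext z
  simp [translate, mul_assoc]

theorem translate_one (A : Set (FreeGroup S × projections S)) : translate 1 A = A := by
  ext z
  simp [translate]

theorem translate_subset_translate {g : FreeGroup S} {A B : Set (FreeGroup S × projections S)} :
    translate g A ⊆ translate g B ↔ A ⊆ B := by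
  refine ⟨fun h z hz => ?_, fun h z hz => h hz⟩
  have := @h (g * z.1, z.2) (by simpa [translate] using hz)
  simpa [translate] using this

/-- The pairs `(h, p)` such that `h` is defined at `p`. -/
def definedPairs (S : Type u) [RestrictionSemigroup S] : Set (FreeGroup S × projections S) :=
  {z | IsDefinedAt z.1 z.2}

/-- The semilattice on which the free group acts: all sets of pairs that are contained in some
translate of `definedPairs S`. -/
def TranslateSets (S : Type u) [RestrictionSemigroup S] : Type u :=
  {A : Set (FreeGroup S × projections S) // ∃ g, A ⊆ translate g (definedPairs S)}

instance : SemilatticeInf (TranslateSets S) :=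
  Subtype.semilatticeInf fun {_ _} ⟨g, hg⟩ _ => ⟨g, Set.inter_subset_left.trans hg⟩

theorem TranslateSets.coe_inf (A B : TranslateSets S) : (A ⊓ B).1 = A.1 ∩ B.1 := rfl

theorem TranslateSets.le_iff {A B : TranslateSets S} : A ≤ B ↔ A.1 ⊆ B.1 := Iff.rfl

/-- The action of the free group on sets of pairs by left translation. -/
def translateAction (S : Type u) [RestrictionSemigroup S] :
    FreeGroup S →* (TranslateSets S ≃o TranslateSets S) where
  toFun g :=
    { toFun A := ⟨translate g A.1, by
        obtain ⟨h, hh⟩ := A.2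
        exact ⟨g * h, by rw [translate_mul]; exact translate_subset_translate.2 hh⟩⟩
      invFun A := ⟨translate g⁻¹ A.1, by
        obtain ⟨h, hh⟩ := A.2
        exact ⟨g⁻¹ * h, by rw [translate_mul]; exact translate_subset_translate.2 hh⟩⟩
      left_inv A := Subtype.ext (by simp [← translate_mul, translate_one])
      right_inv A := Subtype.ext (by simp [← translate_mul, translate_one])
      map_rel_iff' := translate_subset_translate }
  map_one' := OrderIso.ext (funext fun A => Subtype.ext (translate_one A.1))
  map_mul' g h := OrderIso.ext (funext fun A => Subtype.ext (translate_mul g h A.1))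

@[simp] theorem translateAction_coe (g : FreeGroup S) (A : TranslateSets S) :
    (translateAction S g A).1 = translate g A.1 := rfl

/-- The set `definedPairs S`, as an element of the semilattice. -/
def base (S : Type u) [RestrictionSemigroup S] : TranslateSets S :=
  ⟨definedPairs S, 1, by rw [translate_one]⟩

/-- The pairs `(h, p)` such that `h` maps `p` below the projection `e`. -/
def below (e : projections S) : TranslateSets S :=
  ⟨{z | ∃ q, Reaches z.1 z.2 q ∧ q ≤ e}, 1, by
    rw [translate_one]
    exact fun z ⟨q, hq, _⟩ => ⟨q, hq⟩⟩

theorem mem_below {e : projections S} {z : FreeGroup S × projections S} :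
    z ∈ (below e).1 ↔ ∃ q, Reaches z.1 z.2 q ∧ q ≤ e := Iff.rfl

theorem below_inf (e f : projections S) : below (e ⊓ f) = below e ⊓ below f := by
  apply Subtype.ext
  ext z
  rw [TranslateSets.coe_inf, Set.mem_inter_iff, mem_below, mem_below, mem_below]
  constructor
  · rintro ⟨q, hq, hqe⟩
    exact ⟨⟨q, hq, hqe.trans inf_le_left⟩, ⟨q, hq, hqe.trans inf_le_right⟩⟩
  · rintro ⟨⟨q, hq, hqe⟩, ⟨q', hq', hqf⟩⟩
    obtain rfl := hq.unique hq'
    exact ⟨q, hq, le_inf hqe hqf⟩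

theorem reaches_one (p : projections S) : Reaches 1 p p := by
  simp [Reaches, WordMaps]

theorem below_injective : Function.Injective (below : projections S → TranslateSets S) := by
  have key : ∀ e f : projections S, below e = below f → e ≤ f := by
    intro e f h
    have : ((1 : FreeGroup S), e) ∈ (below f).1 := by
      rw [← h]
      exact ⟨e, reaches_one e, le_rfl⟩
    obtain ⟨q, hq, hqf⟩ := this
    rwa [(reaches_one e).unique hq]
  exact fun e f h => le_antisymm (key e f h) (key f e h.symm)

/-- For `e ≤ x⁺`, the letter `x` maps the projections below `(ex)^*` bijectively onto those
below `e`, so its global action maps `below ((ex)^*)` to `below e`. -/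
theorem below_eq_letter {e : projections S} {x : S} (h : e ≤ plusProj x) :
    below e = translateAction S (FreeGroup.of x) (below (astProj (e * x))) := by
  apply Subtype.ext
  ext ⟨g, p⟩
  rw [translateAction_coe]
  change (g, p) ∈ (below e).1 ↔ ((FreeGroup.of x)⁻¹ * g, p) ∈ (below (astProj (e * x))).1
  rw [mem_below, mem_below]
  constructor
  · rintro ⟨q, hq, hqe⟩
    have hqx : LetterMaps (x, false) q (astProj (q * x)) :=
      ⟨q * x, natLE_coe_mul q x, plusProj_coe_mul_of_le (hqe.trans h), rfl⟩
    refine ⟨_, hq.letter_mul hqx, ?_⟩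
    rw [← proj_le_iff.1 hqe, mul_assoc]
    exact astProj_mul_le _ _
  · rintro ⟨q, hq, hqe⟩
    have hqx : LetterMaps (x, true) q (plusProj (e * x * q)) := by
      refine ⟨e * x * q, ?_, astProj_mul_coe_of_le hqe, rfl⟩
      rw [mul_assoc, mul_coe x q, ← coe_plusProj, ← mul_assoc]
      exact natLE_coe_mul (e ⊓ plusProj (x * q)) x
    refine ⟨_, ?_, (plusProj_mul_le (e * x) q).trans ?_⟩
    · convert hq.letter_mul hqx using 1
      rw [← mul_assoc, show FreeGroup.mk [(x, true)] = FreeGroup.of x from rfl, mul_inv_cancel,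
        one_mul]
    · rw [plusProj_coe_mul]
      exact inf_le_left

/-! ### The proper cover -/

/-- The product `a w₁ ⋯ wₙ` in `S` of `a` and the letters of the word `w`. -/
def mulWord (a : S) (w : FreeMonoid S) : S :=
  w.toList.foldl (· * ·) a

@[simp] theorem mulWord_one (a : S) : mulWord a 1 = a := rfl

theorem mulWord_of_mul (a x : S) (w : FreeMonoid S) :
    mulWord a (FreeMonoid.of x * w) = mulWord (a * x) w := rfl

theorem mulWord_mul (a : S) (v w : FreeMonoid S) :
    mulWord a (v * w) = mulWord (mulWord a v) w :=
  List.foldl_append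

theorem mul_mulWord (a b : S) (w : FreeMonoid S) : a * mulWord b w = mulWord (a * b) w := by
  induction w using FreeMonoid.inductionOn' generalizing b with
  | one => rfl
  | of_mul x w ih => rw [mulWord_of_mul, mulWord_of_mul, ih, mul_assoc]

theorem plusProj_mulWord_le (a : S) (w : FreeMonoid S) : plusProj (mulWord a w) ≤ plusProj a := by
  induction w using FreeMonoid.inductionOn' generalizing a with
  | one => exact le_rfl
  | of_mul x w ih => exact (ih (a * x)).trans (plusProj_mul_le a x)

/-- The elements of the proper cover of `S`: the pairs of an element `s` and a word `w` such that
`s` lies below the product of `w`, in the sense that `s = s⁺w`. -/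
@[ext]
structure Cover (S : Type u) [RestrictionSemigroup S] : Type u where
  elem : S
  word : FreeMonoid S
  mulWord_plus : mulWord (plus elem) word = elem

/-- The cover is a subalgebra of the product of `S` and the free monoid on `S`, where `w⁺ = w^* = 1`
for each word `w`. -/
instance : RestrictionSemigroup (Cover S) where
  mul a b := ⟨a.elem * b.elem, a.word * b.word, by
    have h : plus (a.elem * b.elem) = plus (a.elem * b.elem) * plus a.elem := by
      rw [plus_mul_comm, plus_mul_plus_mul]
    rw [mulWord_mul, h, ← mul_mulWord, a.mulWord_plus, ← mul_plus, ← mul_mulWord,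
      b.mulWord_plus]⟩
  plus a := ⟨plus a.elem, 1, plus_plus _⟩
  ast a := ⟨ast a.elem, 1, plus_ast _⟩
  mul_assoc a b c := Cover.ext (mul_assoc _ _ _) (mul_assoc _ _ _)
  plus_mul_self a := Cover.ext (plus_mul_self _) (one_mul _)
  plus_mul_comm a b := Cover.ext (plus_mul_comm _ _) rfl
  plus_plus_mul a b := Cover.ext (plus_plus_mul _ _) (one_mul _).symm
  mul_plus a b := Cover.ext (mul_plus _ _) ((mul_one _).trans (one_mul _).symm)
  self_mul_ast a := Cover.ext (self_mul_ast _) (mul_one _)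
  ast_mul_comm a b := Cover.ext (ast_mul_comm _ _) rfl
  ast_mul_ast a b := Cover.ext (ast_mul_ast _ _) (one_mul _).symm
  ast_mul a b := Cover.ext (ast_mul _ _) ((one_mul _).trans (mul_one _).symm)
  ast_plus a := Cover.ext (ast_plus _) rfl
  plus_ast a := Cover.ext (plus_ast _) rfl

namespace Cover

@[simp] theorem mul_elem (a b : Cover S) : (a * b).elem = a.elem * b.elem := rfl

@[simp] theorem mul_word (a b : Cover S) : (a * b).word = a.word * b.word := rfl

@[simp] theorem plus_elem (a : Cover S) : (plus a).elem = plus a.elem := rfl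

@[simp] theorem plus_word (a : Cover S) : (plus a).word = 1 := rfl

theorem isHom_elem : IsHom (elem : Cover S → S) := ⟨fun _ _ => rfl, fun _ => rfl, fun _ => rfl⟩

theorem elem_surjective : Function.Surjective (elem : Cover S → S) := fun s =>
  ⟨⟨s, FreeMonoid.of s, plus_mul_self s⟩, rfl⟩

theorem elem_injOn_projections :
    ∀ e ∈ projections (Cover S), ∀ f ∈ projections (Cover S), e.elem = f.elem → e = f := by
  rintro _ ⟨a, rfl⟩ _ ⟨b, rfl⟩ h
  exact Cover.ext h rfl

end Cover

/-- The canonical morphism from the free monoid on `S` to the free group on `S`. -/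
def wordToGroup (S : Type u) : FreeMonoid S →* FreeGroup S :=
  FreeMonoid.lift FreeGroup.of

theorem wordToGroup_ofList {S : Type u} (l : List S) :
    wordToGroup S (FreeMonoid.ofList l) = FreeGroup.mk (l.map fun x => (x, true)) := by
  induction l with
  | nil => rfl
  | cons x l ih =>
    rw [FreeMonoid.ofList_cons, map_mul, ih]
    rfl

theorem wordToGroup_injective (S : Type u) : Function.Injective (wordToGroup S) := by
  classical
  have h : ∀ l : List S, (wordToGroup S (FreeMonoid.ofList l)).toWord =
      l.map fun x => (x, true) := by
    intro l
    rw [wordToGroup_ofList, FreeGroup.toWord_mk]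
    apply FreeGroup.IsReduced.reduce_eq
    rw [FreeGroup.IsReduced, List.isChain_map]
    exact (List.pairwise_of_forall fun _ _ _ => rfl).isChain
  intro v w hvw
  have := (h v.toList).symm.trans ((congrArg FreeGroup.toWord hvw).trans (h w.toList))
  have hinj : Function.Injective fun x : S => (x, true) := fun _ _ h => congrArg Prod.fst h
  exact FreeMonoid.toList.injective (hinj.list_map this)

/-- The action of the free monoid that is the restriction of the action of the free group. -/
def wordAction (S : Type u) [RestrictionSemigroup S] :
    FreeMonoid S →* (TranslateSets S ≃o TranslateSets S) :=
  (translateAction S).comp (wordToGroup S)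

/-- If every letter of `w` is defined where needed in the product `rw`, then the global action of
`w` maps the domain of `rw` to the domain of `r`. -/
theorem below_eq_word (r : S) (w : FreeMonoid S) (h : plusProj (mulWord r w) = plusProj r) :
    below (astProj r) = wordAction S w (below (astProj (mulWord r w))) := by
  induction w using FreeMonoid.inductionOn' generalizing r with
  | one => simp
  | of_mul x w ih =>
    rw [mulWord_of_mul] at h ⊢
    have h1 : plusProj (r * x) = plusProj r :=
      le_antisymm (plusProj_mul_le r x) (h ▸ plusProj_mulWord_le (r * x) w)
    have hx : astProj r ≤ plusProj x := by
      have : r * plus x = r := by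
        rw [mul_plus, show plus (r * x) = plus r from congrArg Subtype.val h1, plus_mul_self]
      have := astProj_mul_coe r (plusProj x)
      rw [coe_plusProj, ‹r * plus x = r›] at this
      exact inf_eq_left.1 this.symm
    rw [map_mul, RelIso.mul_apply, ← ih (r * x) (h.trans h1.symm), below_eq_letter hx,
      coe_astProj, astProj_ast_mul]
    rfl

namespace Cover

theorem below_plus_elem (a : Cover S) :
    below (plusProj a.elem) = wordAction S a.word (below (astProj a.elem)) := by
  have := below_eq_word (plus a.elem) a.word
    (by rw [a.mulWord_plus]; exact (plusProj_coe (plusProj a.elem)).symm)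
  rwa [a.mulWord_plus, ← coe_plusProj, astProj_coe] at this

/-- The embedding of the cover in the semidirect product of the semilattice of translates by the
free monoid. -/
def toSemidirect (a : Cover S) : SemilatticeSemidirect (wordAction S) :=
  ⟨below (plusProj a.elem), a.word⟩

theorem isHom_toSemidirect : IsHom (toSemidirect : Cover S → _) where
  map_mul a b := by
    apply SemilatticeSemidirect.ext
    · -- `a b⁺` lies below the word of `a` as well, and has the same range as `ab`
      have h := below_plus_elem (a * plus b)
      rw [mul_elem, mul_word, plus_elem, plus_word, mul_one, plusProj_mul_plus, ← coe_plusProj,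
        astProj_mul_coe, below_inf, map_inf, ← below_plus_elem] at h
      exact h
    · rfl
  map_plus a := by
    apply SemilatticeSemidirect.ext
    · exact congrArg below (plusProj_coe (plusProj a.elem))
    · rfl
  map_ast a := by
    apply SemilatticeSemidirect.ext
    · change below (plusProj (ast a.elem)) =
        (wordAction S a.word).symm (below (plusProj a.elem))
      rw [below_plus_elem, OrderIso.symm_apply_apply]
      exact congrArg below (plusProj_coe (astProj a.elem))
    · rfl

theorem toSemidirect_injective : Function.Injective (toSemidirect : Cover S → _) := by
  intro a b h
  have hw : a.word = b.word := congrArg SemilatticeSemidirect.snd h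
  have he : plusProj a.elem = plusProj b.elem :=
    below_injective (congrArg SemilatticeSemidirect.fst h)
  refine Cover.ext ?_ hw
  rw [← a.mulWord_plus, ← b.mulWord_plus, hw, ← coe_plusProj, he, coe_plusProj]

theorem isProper : IsProper (Cover S) :=
  (SemilatticeSemidirect.isProper (wordAction S)).of_embeds
    ⟨toSemidirect, isHom_toSemidirect, toSemidirect_injective⟩

theorem isProperCover : IsProperCover (Cover S) S :=
  ⟨isProper, elem, isHom_elem, elem_surjective, elem_injOn_projections⟩

theorem embeds_wordAction : Embeds (Cover S) (SemilatticeSemidirect (wordAction S)) :=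
  ⟨toSemidirect, isHom_toSemidirect, toSemidirect_injective⟩

end Cover

end RestrictionSemigroup

namespace SemilatticeSemidirect

open RestrictionSemigroup

/-- A semidirect product by a submonoid of a monoid embeds in the semidirect product by the
whole monoid. -/
theorem embeds_of_comp {Y : Type u} {T : Type v} {G : Type w} [SemilatticeInf Y] [Monoid T]
    [Monoid G] (β : G →* (Y ≃o Y)) {ι : T →* G} (hι : Function.Injective ι) :
    Embeds (SemilatticeSemidirect (β.comp ι)) (SemilatticeSemidirect β) := by
  refine ⟨fun x => ⟨x.fst, ι x.snd⟩, ⟨fun x y => ?_, fun x => ?_, fun x => ?_⟩, fun x y h => ?_⟩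
  · exact SemilatticeSemidirect.ext rfl (map_mul ι _ _)
  · exact SemilatticeSemidirect.ext rfl (map_one ι)
  · exact SemilatticeSemidirect.ext rfl (map_one ι)
  · exact SemilatticeSemidirect.ext (congrArg fst h :) (hι (congrArg snd h :))

end SemilatticeSemidirect

namespace RestrictionSemigroup

variable {S : Type u} [RestrictionSemigroup S]

theorem Embeds.trans {A : Type u} {B : Type v} {C : Type w} [RestrictionSemigroup A]
    [RestrictionSemigroup B] [RestrictionSemigroup C] (h : Embeds A B) (h' : Embeds B C) :
    Embeds A C := by
  obtain ⟨f, hf, hfi⟩ := h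
  obtain ⟨g, hg, hgi⟩ := h'
  exact ⟨g ∘ f, hg.comp hf, hgi.comp hfi⟩

/-! ### Nice factorisations -/

/-- Every word in the letters `x` and `x⁻¹` is a concatenation of blocks, the letters of the block
with index `i` having sign `b` if `i` is even, and the opposite sign if `i` is odd. The blocks may
be empty. -/
theorem exists_alternating_blocks {α : Type u} (L : List (α × Bool)) (b : Bool) :
    ∃ Ls : List (List (α × Bool)), Ls.flatten = L ∧
      ∀ (i : ℕ) (hi : i < Ls.length), ∀ y ∈ Ls[i], y.2 = (b ^^ i.bodd) := by
  induction L generalizing b with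
  | nil => exact ⟨[], rfl, by simp⟩
  | cons y L ih =>
    have same : ∃ Ls : List (List (α × Bool)), Ls.flatten = y :: L ∧
        ∀ (i : ℕ) (hi : i < Ls.length), ∀ z ∈ Ls[i], z.2 = (y.2 ^^ i.bodd) := by
      obtain ⟨Ls, rfl, h⟩ := ih y.2
      cases Ls with
      | nil => exact ⟨[[y]], rfl, by simp⟩
      | cons l Ls =>
        refine ⟨(y :: l) :: Ls, rfl, fun i hi z hz => ?_⟩
        cases i with
        | zero =>
          rcases List.mem_cons.1 hz with rfl | hz
          · simp
          · exact h 0 (by simp) z hz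
        | succ i => exact h (i + 1) (by simpa using hi) z (by simpa using hz)
    by_cases hb : y.2 = b
    · rwa [hb] at same
    · obtain ⟨Ls, hLs, h⟩ := same
      refine ⟨[] :: Ls, by simpa using hLs, fun i hi z hz => ?_⟩
      cases i with
      | zero => simp at hz
      | succ i =>
        have := h i (by simpa using hi) z (by simpa using hz)
        rw [this, Nat.bodd_succ, Bool.eq_not.2 hb]
        cases b <;> cases i.bodd <;> rfl

theorem exists_word_of_forall_true {α : Type u} {l : List (α × Bool)} (h : ∀ y ∈ l, y.2 = true) :
    ∃ t : FreeMonoid α, FreeGroup.mk l = wordToGroup α t := by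
  refine ⟨FreeMonoid.ofList (l.map Prod.fst), ?_⟩
  rw [wordToGroup_ofList, List.map_map]
  congr 1
  conv_lhs => rw [← List.map_id l]
  exact List.map_congr_left fun y hy => Prod.ext rfl (h y hy)

theorem exists_word_of_forall_false {α : Type u} {l : List (α × Bool)}
    (h : ∀ y ∈ l, y.2 = false) : ∃ t : FreeMonoid α, FreeGroup.mk l = (wordToGroup α t)⁻¹ := by
  obtain ⟨t, ht⟩ := exists_word_of_forall_true (l := FreeGroup.invRev l) (by
    intro y hy
    simp only [FreeGroup.invRev, List.mem_reverse, List.mem_map] at hy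
    obtain ⟨z, hz, rfl⟩ := hy
    simp [h z hz])
  exact ⟨t, by rw [← ht, ← FreeGroup.inv_mk, inv_inv]⟩

theorem prod_map_mk {α : Type u} (Ls : List (List (α × Bool))) :
    (Ls.map FreeGroup.mk).prod = FreeGroup.mk Ls.flatten := by
  induction Ls with
  | nil => rfl
  | cons l Ls ih =>
    rw [List.map_cons, List.prod_cons, ih]
    rfl

/-- The blocks of the reduced word of `g` form a nice factorisation of `g`. -/
theorem exists_isNiceFactorisation (g : FreeGroup S) :
    ∃ (n : ℕ) (w : Fin n → FreeGroup S),
      IsNiceFactorisation (wordToGroup S) (translateAction S) (base S) g n w := by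
  classical
  obtain ⟨Ls, hLs, hsign⟩ := exists_alternating_blocks g.toWord true
  have hw : List.ofFn (fun i : Fin Ls.length => FreeGroup.mk Ls[i]) = Ls.map FreeGroup.mk := by
    apply List.ext_getElem <;> simp
  refine ⟨Ls.length, fun i => FreeGroup.mk Ls[i], ?_, ?_, ?_⟩
  · have ht : ∀ i : Fin Ls.length, ∃ t : FreeMonoid S, FreeGroup.mk Ls[i] =
        wordToGroup S t ^ (((if (i : ℕ).bodd then -1 else 1 : ℤˣ)) : ℤ) := by
      intro i
      have h := hsign i i.2
      cases hi : (i : ℕ).bodd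
      · obtain ⟨t, ht⟩ := exists_word_of_forall_true (l := Ls[i]) fun y hy => by
          rw [h y hy, hi]; rfl
        exact ⟨t, by simpa using ht⟩
      · obtain ⟨t, ht⟩ := exists_word_of_forall_false (l := Ls[i]) fun y hy => by
          rw [h y hy, hi]; rfl
        exact ⟨t, by simpa using ht⟩
    choose t ht using ht
    refine ⟨t, fun i => if (i : ℕ).bodd then -1 else 1, ht, fun i j => ?_⟩
    have hi := Nat.mod_two_of_bodd (i : ℕ)
    have hj := Nat.mod_two_of_bodd (j : ℕ)
    have hne : (-1 : ℤˣ) ≠ 1 := by decide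
    cases hbi : (i : ℕ).bodd <;> cases hbj : (j : ℕ).bodd <;>
      simp only [hbi, hbj, Bool.toNat_true, Bool.toNat_false, if_true, if_false,
        Bool.false_eq_true, hne, hne.symm, true_iff, false_iff] at hi hj ⊢ <;> omega
  · rw [hw, prod_map_mk, hLs, FreeGroup.mk_toWord]
  · intro i hi
    rw [hw, ← List.map_drop, prod_map_mk, TranslateSets.le_iff]
    rintro ⟨h, p⟩ ⟨hh, hd⟩
    have hdrop : (Ls.drop (i : ℕ)).flatten = Ls[i] ++ (Ls.drop (i + 1)).flatten := by
      rw [List.drop_eq_getElem_cons i.2]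
      rfl
    rw [hdrop] at hd
    refine IsDefinedAt.of_append (FreeGroup.isReduced_toWord (x := g).infix ?_) hh hd
    rw [← hLs, ← hdrop]
    refine List.IsSuffix.isInfix ⟨(Ls.take i).flatten, ?_⟩
    rw [← List.flatten_append, List.take_append_drop]

theorem isNiceSemidirect_wordAction (S : Type u) [RestrictionSemigroup S] :
    IsNiceSemidirect (wordAction S) := by
  refine ⟨FreeGroup S, inferInstance, wordToGroup S, translateAction S, base S,
    wordToGroup_injective S, fun _ => rfl, fun A => ?_, exists_isNiceFactorisation⟩
  obtain ⟨g, hg⟩ := A.2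
  refine ⟨g, translateAction S g⁻¹ A, ?_, ?_⟩
  · rw [TranslateSets.le_iff, translateAction_coe, ← translate_subset_translate (g := g),
      ← translate_mul, mul_inv_cancel, translate_one]
    exact hg
  · rw [← RelIso.mul_apply, ← map_mul, mul_inv_cancel, map_one]
    rfl

/-! ### Quotients -/

/-- The quotient of a restriction semigroup by a congruence. -/
abbrev quotientRestrictionSemigroup {C : Type u} [RestrictionSemigroup C] (r : Setoid C)
    (hmul : ∀ a a' b b' : C, r a a' → r b b' → r (a * b) (a' * b'))
    (hplus : ∀ a b : C, r a b → r (plus a) (plus b))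
    (hast : ∀ a b : C, r a b → r (ast a) (ast b)) :
    RestrictionSemigroup (Quotient r) where
  mul := Quotient.map₂ (· * ·) fun a a' h b b' h' => hmul a a' b b' h h'
  plus := Quotient.map plus hplus
  ast := Quotient.map ast hast
  mul_assoc := by
    rintro ⟨x⟩ ⟨y⟩ ⟨z⟩
    exact congrArg (Quotient.mk r) (mul_assoc x y z)
  plus_mul_self := by
    rintro ⟨x⟩
    exact congrArg (Quotient.mk r) (plus_mul_self x)
  plus_mul_comm := by
    rintro ⟨x⟩ ⟨y⟩
    exact congrArg (Quotient.mk r) (plus_mul_comm x y)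
  plus_plus_mul := by
    rintro ⟨x⟩ ⟨y⟩
    exact congrArg (Quotient.mk r) (plus_plus_mul x y)
  mul_plus := by
    rintro ⟨x⟩ ⟨y⟩
    exact congrArg (Quotient.mk r) (mul_plus x y)
  self_mul_ast := by
    rintro ⟨x⟩
    exact congrArg (Quotient.mk r) (self_mul_ast x)
  ast_mul_comm := by
    rintro ⟨x⟩ ⟨y⟩
    exact congrArg (Quotient.mk r) (ast_mul_comm x y)
  ast_mul_ast := by
    rintro ⟨x⟩ ⟨y⟩
    exact congrArg (Quotient.mk r) (ast_mul_ast x y)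
  ast_mul := by
    rintro ⟨x⟩ ⟨y⟩
    exact congrArg (Quotient.mk r) (ast_mul x y)
  ast_plus := by
    rintro ⟨x⟩
    exact congrArg (Quotient.mk r) (ast_plus x)
  plus_ast := by
    rintro ⟨x⟩
    exact congrArg (Quotient.mk r) (plus_ast x)

/-! ### Factorisable restriction monoids -/

/-- In a factorisable restriction monoid, the principal order ideals generated by the elements of
`U(F)` witness almost factorisability. -/
theorem IsFactorisable.isAlmostFactorisable {F : Type u} [RestrictionMonoid F]
    (h : IsFactorisable F) : IsAlmostFactorisable F := by
  intro s
  obtain ⟨e, he, t, ⟨ht, ht'⟩, rfl⟩ := h s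
  have hp : ∀ f : projections F, plus (f * t) = f := by
    intro f
    have := congrArg Subtype.val (plusProj_coe_mul f t)
    rwa [coe_plusProj, coe_inf, coe_plusProj, ht, mul_one] at this
  have hle : ∀ f : projections F, f ≤ plusProj t := fun f => by
    rw [proj_le_iff, coe_plusProj, ht, mul_one]
  have hle' : ∀ f : projections F, f ≤ astProj t := fun f => by
    rw [proj_le_iff, coe_astProj, ht', mul_one]
  refine ⟨Set.range fun f : projections F => (f : F) * t, ⟨?_, ?_⟩, ⟨⟨e, he⟩, rfl⟩, ?_, ?_⟩
  · rintro _ ⟨f, rfl⟩ x hx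
    refine ⟨plusProj x ⊓ f, ?_⟩
    change (plus x * f : F) * t = x
    rw [mul_assoc]
    exact hx.symm
  · rintro _ ⟨f, rfl⟩ _ ⟨g, rfl⟩
    refine ⟨?_, ?_⟩
    · simp only [hp]
      rw [← mul_assoc, ← mul_assoc, coe_mul_coe_comm]
    · have key : ∀ f a : F, f * t = t * ast (f * t) → f * t * a = t * (ast (f * t) * a) :=
        fun f a h => by rw [← mul_assoc, ← h]
      exact (key f _ (coe_mul f t)).trans
        ((congrArg (t * ·) (ast_mul_comm _ _)).trans (key g _ (coe_mul g t)).symm)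
  · ext x
    constructor
    · rintro ⟨_, ⟨f, rfl⟩, rfl⟩
      exact ⟨_, rfl⟩
    · intro hx
      exact ⟨_, ⟨⟨x, hx⟩, rfl⟩, hp _⟩
  · ext x
    constructor
    · rintro ⟨_, ⟨f, rfl⟩, rfl⟩
      exact (astProj _).2
    · intro hx
      refine ⟨_, ⟨plusProj (t * x), rfl⟩, ?_⟩
      have := mul_coe t (⟨x, hx⟩ : projections F)
      simp only [coe_plusProj] at this ⊢
      rw [← this]
      exact congrArg Subtype.val (astProj_mul_coe_of_le (hle' ⟨x, hx⟩))

/-- If the semilattice `Y` has a greatest element, then each quotient of the semidirect product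
`Y ⋊ T` is a restriction monoid. -/
abbrev quotientRestrictionMonoid {Y : Type u} {T : Type v} [SemilatticeInf Y] [OrderTop Y]
    [Monoid T] {α : T →* (Y ≃o Y)} (r : Setoid (SemilatticeSemidirect α))
    (hmul : ∀ a a' b b', r a a' → r b b' → r (a * b) (a' * b'))
    (hplus : ∀ a b, r a b → r (plus a) (plus b))
    (hast : ∀ a b, r a b → r (ast a) (ast b)) :
    RestrictionMonoid (Quotient r) where
  toRestrictionSemigroup := quotientRestrictionSemigroup r hmul hplus hast
  one := Quotient.mk r ⟨⊤, 1⟩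
  one_mul := by
    rintro ⟨x⟩
    refine congrArg (Quotient.mk r) (SemilatticeSemidirect.ext ?_ (one_mul _))
    simp
  mul_one := by
    rintro ⟨x⟩
    refine congrArg (Quotient.mk r) (SemilatticeSemidirect.ext ?_ (mul_one _))
    simp

theorem isFactorisable_quotient {Y : Type u} {T : Type v} [SemilatticeInf Y] [OrderTop Y]
    [Monoid T] {α : T →* (Y ≃o Y)} (r : Setoid (SemilatticeSemidirect α))
    (hmul : ∀ a a' b b', r a a' → r b b' → r (a * b) (a' * b'))
    (hplus : ∀ a b, r a b → r (plus a) (plus b))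
    (hast : ∀ a b, r a b → r (ast a) (ast b)) :
    @IsFactorisable (Quotient r) (quotientRestrictionMonoid r hmul hplus hast) := by
  let := quotientRestrictionMonoid r hmul hplus hast
  rintro ⟨⟨a, t⟩⟩
  refine ⟨plus (Quotient.mk r ⟨a, t⟩), ⟨_, rfl⟩, Quotient.mk r ⟨⊤, t⟩, ⟨rfl, ?_⟩, ?_⟩
  · refine congrArg (Quotient.mk r) (SemilatticeSemidirect.ext ?_ rfl)
    simp
  · refine congrArg (Quotient.mk r) (SemilatticeSemidirect.ext ?_ (one_mul _).symm)
    simp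

/-! ### Labelled permutations -/

/-- A permutation of two disjoint copies of the projections, together with labels in `S ∪ {0}`. An
arrow from a point `z` to its image may have a nonzero label only within the left-hand copy, and
then the label is an element of `S` whose domain is `z` and whose range is the image of `z`. -/
@[ext]
structure LabelledPerm (S : Type u) [RestrictionSemigroup S] : Type u where
  perm : Equiv.Perm (projections S ⊕ projections S)
  label : projections S ⊕ projections S → WithZero S
  of_label : ∀ (z : projections S ⊕ projections S) (s : S), label z = s →
    z = Sum.inl (astProj s) ∧ perm z = Sum.inl (plusProj s)

namespace LabelledPerm

/-- Labelled permutations are composed like arrows of a category: the labels along a path are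
multiplied. The labels of the identity are the projections on the left-hand copy. -/
instance : Monoid (LabelledPerm S) where
  mul t u := ⟨t.perm * u.perm, fun z => t.label (u.perm z) * u.label z, by
    intro z s hs
    cases hu : u.label z with
    | zero => simp [hu] at hs
    | coe b =>
      cases ht : t.label (u.perm z) with
      | zero => simp [ht] at hs
      | coe a =>
        rw [hu, ht, ← WithZero.coe_mul, WithZero.coe_inj] at hs
        obtain ⟨hz, huz⟩ := u.of_label z b hu
        obtain ⟨hz', htz⟩ := t.of_label _ a ht
        subst hs
        have hab : astProj a = plusProj b := Sum.inl_injective (hz'.symm.trans huz)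
        constructor
        · rw [hz, ← astProj_ast_mul, ← coe_astProj, hab, coe_plusProj, plus_mul_self]
        · rw [Equiv.Perm.mul_apply, htz, ← plusProj_mul_plus, ← coe_plusProj b, ← hab,
            coe_astProj, self_mul_ast]⟩
  one := ⟨1, Sum.elim (fun p => ((p : S) : WithZero S)) fun _ => 0, by
    rintro (p | p) s hs
    · obtain rfl : (p : S) = s := WithZero.coe_inj.1 hs
      simp
    · simp at hs⟩
  mul_assoc t u v := by
    refine LabelledPerm.ext rfl (funext fun z => ?_)
    exact mul_assoc (t.label (u.perm (v.perm z))) (u.label (v.perm z)) (v.label z)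
  one_mul t := by
    refine LabelledPerm.ext rfl (funext fun z => ?_)
    change Sum.elim (fun p : projections S => ((p : S) : WithZero S)) (fun _ => 0) (t.perm z) *
      t.label z = t.label z
    cases ht : t.label z with
    | zero => simp
    | coe a =>
      rw [(t.of_label z a ht).2, Sum.elim_inl, ← WithZero.coe_mul, coe_plusProj, plus_mul_self]
  mul_one t := by
    refine LabelledPerm.ext rfl (funext fun z => ?_)
    change t.label z *
      Sum.elim (fun p : projections S => ((p : S) : WithZero S)) (fun _ => 0) z = t.label z
    cases ht : t.label z with
    | zero => simp
    | coe a =>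
      rw [(t.of_label z a ht).1, Sum.elim_inl, ← WithZero.coe_mul, coe_astProj, self_mul_ast]

/-- The germ of `t` at `z`: the source and the label of the arrow of `t` with target `z`. -/
def germ (t : LabelledPerm S) (z : projections S ⊕ projections S) :
    (projections S ⊕ projections S) × WithZero S :=
  (t.perm.symm z, t.label (t.perm.symm z))

theorem germ_mul (t u : LabelledPerm S) (z : projections S ⊕ projections S) :
    germ (t * u) z =
      ((germ u (germ t z).1).1, (germ t z).2 * (germ u (germ t z).1).2) := by
  have h : (t * u).perm.symm z = u.perm.symm (t.perm.symm z) := rfl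
  simp only [germ, h]
  congr 1
  change t.label (u.perm (u.perm.symm (t.perm.symm z))) * _ = _
  rw [Equiv.apply_symm_apply]

theorem germ_one_inl (p : projections S) :
    germ (1 : LabelledPerm S) (Sum.inl p) = (Sum.inl p, ((p : S) : WithZero S)) := rfl

/-- The action of labelled permutations on sets of points. -/
def setAction (S : Type u) [RestrictionSemigroup S] :
    LabelledPerm S →*
      (Set (projections S ⊕ projections S) ≃o Set (projections S ⊕ projections S)) where
  toFun t :=
    { toFun A := t.perm.symm ⁻¹' A
      invFun A := t.perm ⁻¹' A
      left_inv A := by ext; simp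
      right_inv A := by ext; simp
      map_rel_iff' := t.perm.symm.surjective.preimage_subset_preimage_iff }
  map_one' := rfl
  map_mul' t u := rfl

theorem mem_setAction {t : LabelledPerm S} {A : Set (projections S ⊕ projections S)}
    {z : projections S ⊕ projections S} :
    z ∈ setAction S t A ↔ (germ t z).1 ∈ A := Iff.rfl

theorem mem_setAction_symm {t : LabelledPerm S} {A : Set (projections S ⊕ projections S)}
    {z : projections S ⊕ projections S} :
    z ∈ (setAction S t).symm A ↔ t.perm z ∈ A := Iff.rfl

/-- The congruence that identifies `(A, t)` and `(A, u)` if the arrows of `t` and `u` with target in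
`A` are the same. -/
def germSetoid (S : Type u) [RestrictionSemigroup S] :
    Setoid (SemilatticeSemidirect (setAction S)) where
  r x y := x.fst = y.fst ∧ Set.EqOn (germ x.snd) (germ y.snd) x.fst
  iseqv :=
    { refl := fun _ => ⟨rfl, fun _ _ => rfl⟩
      symm := fun h => ⟨h.1.symm, h.1 ▸ h.2.symm⟩
      trans := fun h h' => ⟨h.1.trans h'.1, h.2.trans (h.1.symm ▸ h'.2)⟩ }

theorem germSetoid_iff {x y : SemilatticeSemidirect (setAction S)} :
    germSetoid S x y ↔ x.fst = y.fst ∧ ∀ z ∈ x.fst, germ x.snd z = germ y.snd z := Iff.rfl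

theorem germSetoid_mul (a a' b b' : SemilatticeSemidirect (setAction S))
    (h : germSetoid S a a') (h' : germSetoid S b b') : germSetoid S (a * b) (a' * b') := by
  rw [germSetoid_iff] at h h' ⊢
  simp only [SemilatticeSemidirect.mul_fst, SemilatticeSemidirect.mul_snd]
  refine ⟨?_, fun z hz => ?_⟩
  · rw [← h.1, ← h'.1]
    ext z
    refine and_congr_right fun hz => ?_
    rw [mem_setAction, mem_setAction, h.2 z hz]
  · obtain ⟨hz, hz'⟩ := hz
    rw [mem_setAction] at hz'
    rw [germ_mul, germ_mul, h'.2 _ hz', h.2 z hz]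

theorem germSetoid_plus (a b : SemilatticeSemidirect (setAction S)) (h : germSetoid S a b) :
    germSetoid S (plus a) (plus b) :=
  ⟨h.1, fun _ _ => rfl⟩

theorem germSetoid_ast (a b : SemilatticeSemidirect (setAction S)) (h : germSetoid S a b) :
    germSetoid S (ast a) (ast b) := by
  have key : ∀ a b, germSetoid S a b → (ast a).fst ≤ (ast b).fst := by
    intro a b h z hz
    rw [germSetoid_iff] at h
    rw [SemilatticeSemidirect.ast_fst, mem_setAction_symm] at hz ⊢
    have hg := congrArg Prod.fst (h.2 _ hz)
    simp only [germ, Equiv.symm_apply_apply] at hg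
    have : b.snd.perm z = a.snd.perm z := by rw [Equiv.eq_symm_apply] at hg; exact hg
    rw [this, ← h.1]
    exact hz
  exact ⟨le_antisymm (key a b h) (key b a ((germSetoid S).symm h)), fun _ _ => rfl⟩

end LabelledPerm

/-! ### Extending elements to labelled permutations -/

theorem astProj_plus_mul_of_le {s : S} {p : projections S} (h : p ≤ astProj s) :
    astProj (plus (s * p) * s) = p := by
  rw [← mul_coe, astProj_mul_coe_of_le h]

theorem plusProj_mul_ast_of_le {s : S} {p : projections S} (h : p ≤ plusProj s) :
    plusProj (s * ast (p * s)) = p := by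
  rw [← coe_mul, plusProj_coe_mul_of_le h]

open Classical in
/-- The permutation that extends the partial bijection `p ↦ (sp)⁺` (for `p ≤ s^*`) of the left-hand
copy of the projections. On the right-hand copy it is the inverse partial bijection, and points
at which these are undefined change to the other copy. -/
noncomputable def dilation (s : S) : Equiv.Perm (projections S ⊕ projections S) where
  toFun := Sum.elim
    (fun p => if p ≤ astProj s then Sum.inl (plusProj (s * p)) else Sum.inr p)
    (fun p => if p ≤ plusProj s then Sum.inr (astProj (p * s)) else Sum.inl p)
  invFun := Sum.elim
    (fun p => if p ≤ plusProj s then Sum.inl (astProj (p * s)) else Sum.inr p)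
    (fun p => if p ≤ astProj s then Sum.inr (plusProj (s * p)) else Sum.inl p)
  left_inv := by
    rintro (p | p) <;> simp only [Sum.elim_inl, Sum.elim_inr] <;> split_ifs with h
    · simp [plusProj_mul_le, astProj_plus_mul_of_le h]
    · simp [h]
    · simp [astProj_mul_le, plusProj_mul_ast_of_le h]
    · simp [h]
  right_inv := by
    rintro (p | p) <;> simp only [Sum.elim_inl, Sum.elim_inr] <;> split_ifs with h
    · simp [astProj_mul_le, plusProj_mul_ast_of_le h]
    · simp [h]
    · simp [plusProj_mul_le, astProj_plus_mul_of_le h]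
    · simp [h]

open Classical in
/-- The labelled permutation that extends `s`: a projection `p ≤ s^*` is the source of an arrow with
label `sp`, and the arrows added by the dilation have label `0`. -/
noncomputable def extend (s : S) : LabelledPerm S where
  perm := dilation s
  label := Sum.elim (fun p => if p ≤ astProj s then ((s * p : S) : WithZero S) else 0) fun _ => 0
  of_label := by
    rintro (p | p) a ha
    · simp only [Sum.elim_inl] at ha
      split_ifs at ha with h
      · obtain rfl := WithZero.coe_inj.1 ha
        refine ⟨by rw [astProj_mul_coe_of_le h], ?_⟩
        simp [dilation, h]
      · simp at ha
    · simp at ha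

theorem germ_extend {s : S} {p : projections S} (h : p ≤ plusProj s) :
    (extend s).germ (Sum.inl p) = (Sum.inl (astProj (p * s)), ((p * s : S) : WithZero S)) := by
  have h1 : (extend s).perm.symm (Sum.inl p) = Sum.inl (astProj (p * s)) := by
    simp [extend, dilation, h]
  rw [LabelledPerm.germ, h1]
  have h2 : s * ast (p * s) = p * s := (coe_mul p s).symm
  simp [extend, astProj_mul_le, -WithZero.coe_mul, h2]

/-- The points of the left-hand copy that lie below the projection `e`. -/
def lowerPoints (e : projections S) : Set (projections S ⊕ projections S) :=
  Sum.inl '' Set.Iic e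

@[simp] theorem inl_mem_lowerPoints {e p : projections S} :
    Sum.inl p ∈ lowerPoints e ↔ p ≤ e := by
  simp [lowerPoints]

@[simp] theorem inr_notMem_lowerPoints {e p : projections S} :
    Sum.inr p ∉ lowerPoints e := by
  simp [lowerPoints]

theorem le_plusProj_mul_iff {p : projections S} {s t : S} :
    p ≤ plusProj (s * t) ↔ p ≤ plusProj s ∧ astProj (p * s) ≤ plusProj t := by
  constructor
  · intro h
    refine ⟨h.trans (plusProj_mul_le s t), ?_⟩
    have hps : (p : S) * s * plus t = p * s := by
      rw [mul_assoc, mul_plus, ← mul_assoc, ← coe_plusProj, proj_le_iff.1 h]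
    rw [← inf_eq_left, ← astProj_mul_coe, coe_plusProj, hps]
  · rintro ⟨h, h'⟩
    have hps : (p : S) * s * plus t = p * s := mul_coe_of_astProj_le (e := plusProj t) h'
    rw [← inf_eq_left, ← plusProj_coe_mul, ← mul_assoc, ← plusProj_mul_plus, hps,
      plusProj_coe_mul_of_le h]

/-- The factorisable restriction monoid in which `S` embeds. -/
abbrev GermMonoid (S : Type u) [RestrictionSemigroup S] : Type u :=
  Quotient (LabelledPerm.germSetoid S)

instance : RestrictionMonoid (GermMonoid S) :=
  quotientRestrictionMonoid _ LabelledPerm.germSetoid_mul LabelledPerm.germSetoid_plus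
    LabelledPerm.germSetoid_ast

theorem isFactorisable_germMonoid (S : Type u) [RestrictionSemigroup S] :
    IsFactorisable (GermMonoid S) :=
  isFactorisable_quotient _ _ _ _

theorem isMorphicImage_germMonoid (S : Type u) [RestrictionSemigroup S] :
    IsMorphicImage (SemilatticeSemidirect (LabelledPerm.setAction S)) (GermMonoid S) :=
  ⟨Quotient.mk _, ⟨fun _ _ => rfl, fun _ => rfl, fun _ => rfl⟩, Quotient.mk_surjective⟩

/-- The image of `s` in the factorisable restriction monoid: the set of those arrows of `extend s`
whose labels are nonzero, these labels being the elements below `s`. -/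
noncomputable def toGermMonoid (s : S) : GermMonoid S :=
  Quotient.mk _ ⟨lowerPoints (plusProj s), extend s⟩

theorem isHom_toGermMonoid : IsHom (toGermMonoid : S → GermMonoid S) where
  map_mul s t := by
    refine Quotient.sound (LabelledPerm.germSetoid_iff.2 ⟨?_, ?_⟩)
    · ext (p | p)
      · simp only [SemilatticeSemidirect.mul_fst, inl_mem_lowerPoints, le_plusProj_mul_iff]
        change _ ↔ Sum.inl p ∈ lowerPoints _ ∧ _
        rw [inl_mem_lowerPoints]
        refine and_congr_right fun h => ?_
        rw [LabelledPerm.mem_setAction, germ_extend h, inl_mem_lowerPoints]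
      · simp only [SemilatticeSemidirect.mul_fst, inr_notMem_lowerPoints, false_iff]
        exact fun h => inr_notMem_lowerPoints h.1
    · rintro (p | p) h
      · rw [inl_mem_lowerPoints] at h
        obtain ⟨hs, ht⟩ := le_plusProj_mul_iff.1 h
        simp only [SemilatticeSemidirect.mul_snd]
        rw [LabelledPerm.germ_mul, germ_extend h, germ_extend hs, germ_extend ht,
          ← WithZero.coe_mul, coe_astProj, astProj_ast_mul, ← mul_assoc (p * s : S),
          self_mul_ast, mul_assoc]
      · exact absurd h inr_notMem_lowerPoints
  map_plus s := by
    refine Quotient.sound (LabelledPerm.germSetoid_iff.2 ⟨?_, ?_⟩)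
    · exact congrArg lowerPoints (plusProj_coe (plusProj s))
    · rintro (p | p) h
      · rw [inl_mem_lowerPoints] at h
        have hp : (p : S) * plus s = p := by
          rw [← coe_plusProj, plusProj_coe] at h
          exact h
        simp only [SemilatticeSemidirect.plus_snd]
        rw [germ_extend h, LabelledPerm.germ_one_inl, hp, astProj_coe]
      · exact absurd h inr_notMem_lowerPoints
  map_ast s := by
    refine Quotient.sound (LabelledPerm.germSetoid_iff.2 ⟨?_, ?_⟩)
    · have hs : plusProj (ast s) = astProj s := plusProj_coe (astProj s)
      simp only [SemilatticeSemidirect.ast_fst, hs]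
      ext (p | p)
      · rw [LabelledPerm.mem_setAction_symm]
        by_cases h : p ≤ astProj s <;> simp [extend, dilation, h, plusProj_mul_le]
      · rw [LabelledPerm.mem_setAction_symm]
        by_cases h : p ≤ plusProj s <;> simp [extend, dilation, h]
    · rintro (p | p) h
      · rw [inl_mem_lowerPoints] at h
        have hp : (p : S) * ast s = p := by
          rw [← coe_astProj, plusProj_coe] at h
          exact h
        simp only [SemilatticeSemidirect.ast_snd]
        rw [germ_extend h, LabelledPerm.germ_one_inl, hp, astProj_coe]
      · exact absurd h inr_notMem_lowerPoints

theorem toGermMonoid_injective : Function.Injective (toGermMonoid : S → GermMonoid S) := by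
  intro s t h
  obtain ⟨hst, hg⟩ := LabelledPerm.germSetoid_iff.1 (Quotient.exact h)
  simp only at hst hg
  have hle : plusProj s = plusProj t := le_antisymm
    (inl_mem_lowerPoints.1 (hst ▸ inl_mem_lowerPoints.2 le_rfl))
    (inl_mem_lowerPoints.1 (hst ▸ inl_mem_lowerPoints.2 le_rfl))
  have := congrArg Prod.snd (hg (Sum.inl (plusProj s)) (inl_mem_lowerPoints.2 le_rfl))
  rw [germ_extend le_rfl, germ_extend hle.le] at this
  have := WithZero.coe_inj.1 this
  rwa [coe_plusProj, plus_mul_self, ← coe_plusProj, hle, coe_plusProj, plus_mul_self] at this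

end RestrictionSemigroup

open RestrictionSemigroup in
theorem mainTheorem1 (S : Type u) [RestrictionSemigroup S] :
    -- (i)
    ((∃ (A : Type u) (_ : RestrictionSemigroup A),
        RestrictionSemigroup.IsAlmostFactorisable A ∧
        (∃ (Y T : Type u) (_ : SemilatticeInf Y) (_ : Monoid T) (α : T →* (Y ≃o Y)),
          RestrictionSemigroup.IsMorphicImage (SemilatticeSemidirect α) A) ∧
        RestrictionSemigroup.Embeds S A) ∧
      (∃ (F : Type u) (_ : RestrictionMonoid F),
        RestrictionSemigroup.IsFactorisable F ∧
        (∃ (Y T : Type u) (_ : SemilatticeInf Y) (_ : OrderTop Y) (_ : Monoid T)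
          (α : T →* (Y ≃o Y)), RestrictionSemigroup.IsMorphicImage (SemilatticeSemidirect α) F) ∧
        RestrictionSemigroup.Embeds S F)) ∧
    -- (ii)
    (∃ (C : Type u) (_ : RestrictionSemigroup C),
      RestrictionSemigroup.IsProperCover C S ∧
      (∃ (X T : Type u) (_ : SemilatticeInf X) (_ : Monoid T) (α : T →* (X ≃o X)),
        IsNiceSemidirect α ∧ RestrictionSemigroup.Embeds C (SemilatticeSemidirect α)) ∧
      (∃ (X G : Type u) (_ : SemilatticeInf X) (_ : Group G) (β : G →* (X ≃o X)),
        RestrictionSemigroup.Embeds C (SemilatticeSemidirect β))) := by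
  refine ⟨⟨⟨GermMonoid S, inferInstance, (isFactorisable_germMonoid S).isAlmostFactorisable,
      ⟨_, _, inferInstance, inferInstance, _, isMorphicImage_germMonoid S⟩,
      toGermMonoid, isHom_toGermMonoid, toGermMonoid_injective⟩,
    GermMonoid S, inferInstance, isFactorisable_germMonoid S,
      ⟨_, _, inferInstance, inferInstance, inferInstance, _, isMorphicImage_germMonoid S⟩,
      toGermMonoid, isHom_toGermMonoid, toGermMonoid_injective⟩,
    Cover S, inferInstance, Cover.isProperCover,
      ⟨_, _, inferInstance, inferInstance, wordAction S, isNiceSemidirect_wordAction S,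
        Cover.embeds_wordAction⟩,
      ⟨_, _, inferInstance, inferInstance, translateAction S, Cover.embeds_wordAction.trans
        (SemilatticeSemidirect.embeds_of_comp (translateAction S) (wordToGroup_injective S))⟩⟩
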